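/- Let $S$ be a set of $N$ points in the plane in general position, i.e. no three points of $S$ are collinear. A plane graph on $S$ is a simple graph with vertex set $S$ whose edges, drawn as straight segments between their endpoints, have pairwise disjoint relative interiors. For $i\ge 0$ let $\hat v_i(S)$ denote the expected number of vertices of degree $i$ in a graph chosen uniformly at random from the (finite, non-empty) set of all plane graphs on $S$. Then \[ \hat v_0(S)\ \ge\ \frac{N}{4096}; \qquad \hat v_1(S)\ \ge\ \frac{3N}{1024}\ \text{ if } N\ge 2; \qquad \hat v_2(S)\ \ge\ \frac{33N}{2048}\ \text{ if } N\ge 3. \] -/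

import Mathlib

/-- The Euclidean plane. -/
abbrev Plane : Type := EuclideanSpace ℝ (Fin 2)

/-- A finite planar point set is in general position if no three of its points are collinear. -/
def InGeneralPosition (S : Finset Plane) : Prop :=
  ∀ a ∈ S, ∀ b ∈ S, ∀ c ∈ S, a ≠ b → a ≠ c → b ≠ c → ¬ Collinear ℝ ({a, b, c} : Set Plane)

/-- A graph with vertex set `S`, each edge `ab` being drawn as the straight segment from `a` to `b`,
is crossing-free (a plane graph) if the relative interiors of any two distinct edges are
disjoint. -/
def IsPlaneGraph {S : Finset Plane} (G : SimpleGraph S) : Prop :=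
  ∀ a b c d : S, G.Adj a b → G.Adj c d → s(a, b) ≠ s(c, d) →
    Disjoint (openSegment ℝ (a : Plane) (b : Plane)) (openSegment ℝ (c : Plane) (d : Plane))

open Classical in
/-- The finite set of all plane graphs on `S`. -/
noncomputable def planeGraphs (S : Finset Plane) : Finset (SimpleGraph S) :=
  Finset.univ.filter fun G => IsPlaneGraph G

open Classical in
/-- The number of vertices of degree `i` in `G`. -/
noncomputable def numDegree {S : Finset Plane} (i : ℕ) (G : SimpleGraph S) : ℕ :=
  (Finset.univ.filter fun p : S => G.degree p = i).card

/-- The expected number of vertices of degree `i` in a uniformly random plane graph on `S`.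
The denominator is never zero, because the empty graph is a plane graph. -/
noncomputable def expectedNumDegree (i : ℕ) (S : Finset Plane) : ℝ :=
  (∑ G ∈ planeGraphs S, (numDegree i G : ℝ)) / ((planeGraphs S).card : ℝ)

/-! Fix a point `p` and group the plane graphs by what remains after deleting the edges at `p`. If
`p` sees `k` points in the remaining graph `H`, the graphs in the group arise by joining `p` to an
arbitrary subset of these (`sum_planeGraphs_fiber`), so within the group the degree of `p` is
binomial with parameters `k` and 1/2.

The average degree is at most 6 (`IsPlaneGraph.sum_degree_le`), the mean of that binomial for `k =
12`. Accordingly, in every group the indicator of degree `i` sums to at least `C(12,i)/4096` times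
the sum of `7 - deg p` (`choose_twelve_mul_le`). Summed over `p`, the weight `7 - deg p` is at least
`N` in every plane graph, whence the bound `C(12,i) N / 4096`.

The binomial inequality fails for `k < i`. This is excluded by geometry: an isolated point sees at
least two others whenever there are that many (`le_card_visibleFrom`). -/

/-! ### The edge bound for crossing-free graphs, by charging wedges. -/

section EdgeBound

variable {V : Type*} (X Y : V → ℝ)

/-- The slope of the segment from `a` to `b`. -/
noncomputable def slopeOf (a b : V) : ℝ := (Y b - Y a) / (X b - X a)

/-- The line through `a` and `b`, as a function of the abscissa. -/
noncomputable def segLine (a b : V) (x : ℝ) : ℝ := Y a + slopeOf X Y a b * (x - X a)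

/-- No two edges of `G` cross, when the vertices are placed by the coordinates `X` and `Y`. -/
def NoCrossing (G : SimpleGraph V) : Prop :=
  ∀ a b c d, G.Adj a b → G.Adj c d → X a < X b → X c < X d → s(a, b) ≠ s(c, d) →
    ∀ x, X a < x → X c < x → x < X b → x < X d → segLine X Y a b x ≠ segLine X Y c d x

variable {X Y}

theorem segLine_left (a b : V) : segLine X Y a b (X a) = Y a := by simp [segLine]

theorem segLine_lt_segLine {v a b : V} {x : ℝ} (hx : X v < x)
    (h : slopeOf X Y v a < slopeOf X Y v b) : segLine X Y v a x < segLine X Y v b x := by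
  unfold segLine
  have := mul_lt_mul_of_pos_right h (sub_pos.2 hx)
  linarith

theorem segLine_le_segLine {v a b : V} {x : ℝ} (hx : X v < x)
    (h : slopeOf X Y v a ≤ slopeOf X Y v b) : segLine X Y v a x ≤ segLine X Y v b x := by
  unfold segLine
  have := mul_le_mul_of_nonneg_right h (sub_pos.2 hx).le
  linarith

theorem segLine_right {a b : V} (h : X a < X b) : segLine X Y a b (X b) = Y b := by
  have : X b - X a ≠ 0 := (sub_pos.2 h).ne'
  unfold segLine slopeOf
  field_simp
  ring

theorem slopeOf_le_iff {v w a : V} (h : X v < X w) :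
    slopeOf X Y v a ≤ slopeOf X Y v w ↔ segLine X Y v a (X w) ≤ Y w := by
  rw [← segLine_right (Y := Y) h]
  refine ⟨segLine_le_segLine h, fun H => ?_⟩
  by_contra! h'
  exact absurd (segLine_lt_segLine h h') (not_lt.2 H)

theorem le_slopeOf_iff {v w a : V} (h : X v < X w) :
    slopeOf X Y v w ≤ slopeOf X Y v a ↔ Y w ≤ segLine X Y v a (X w) := by
  rw [← segLine_right (Y := Y) h]
  refine ⟨segLine_le_segLine h, fun H => ?_⟩
  by_contra! h'
  exact absurd (segLine_lt_segLine h h') (not_lt.2 H)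

/-- Two edges of a crossing-free graph cannot exchange their vertical order. -/
theorem NoCrossing.not_swap {G : SimpleGraph V} (hG : NoCrossing X Y G) {a b c d : V}
    (hab : G.Adj a b) (hcd : G.Adj c d) {s t : ℝ} (hst : s < t)
    (has : X a ≤ s) (hcs : X c ≤ s) (hbt : t ≤ X b) (hdt : t ≤ X d)
    (h1 : segLine X Y a b s < segLine X Y c d s) (h2 : segLine X Y c d t < segLine X Y a b t) :
    False := by
  have hne : s(a, b) ≠ s(c, d) := by
    intro h
    rcases Sym2.eq_iff.1 h with ⟨rfl, rfl⟩ | ⟨rfl, rfl⟩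
    · exact lt_irrefl _ h1
    · linarith
  have hcont : ∀ a b : V, Continuous (segLine X Y a b) := fun a b => by
    unfold segLine; fun_prop
  obtain ⟨x, hx, hx0⟩ := intermediate_value_Ioo hst.le
    (((hcont a b).sub (hcont c d)).continuousOn) (show (0 : ℝ) ∈ _ from ⟨sub_neg.2 h1, sub_pos.2 h2⟩)
  exact hG a b c d hab hcd (by linarith) (by linarith) hne x (by linarith [hx.1])
    (by linarith [hx.1]) (by linarith [hx.2]) (by linarith [hx.2]) (sub_eq_zero.1 hx0)

/-- `vq` and `vq'` are consecutive edges to the right of `v`, and `w` is the leftmost vertex in the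
closed wedge that they span. -/
structure IsWedge (X Y : V → ℝ) (G : SimpleGraph V) (v q q' w : V) : Prop where
  adj : G.Adj v q
  adj' : G.Adj v q'
  lt : X v < X q
  lt' : X v < X q'
  slope_lt : slopeOf X Y v q < slopeOf X Y v q'
  slope_le : ∀ r, G.Adj v r → X v < X r → slopeOf X Y v q < slopeOf X Y v r →
    slopeOf X Y v q' ≤ slopeOf X Y v r
  lt_w : X v < X w
  le_w : slopeOf X Y v q ≤ slopeOf X Y v w
  w_le : slopeOf X Y v w ≤ slopeOf X Y v q'
  min_w : ∀ r, X v < X r → slopeOf X Y v q ≤ slopeOf X Y v r →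
    slopeOf X Y v r ≤ slopeOf X Y v q' → X w ≤ X r

theorem exists_isWedge [Finite V] {G : SimpleGraph V} {v q r : V} (hq : G.Adj v q)
    (hlt : X v < X q) (hr : G.Adj v r) (hlt' : X v < X r)
    (hs : slopeOf X Y v q < slopeOf X Y v r) : ∃ q' w, IsWedge X Y G v q q' w := by
  obtain ⟨q', ⟨h1, h2, h3⟩, hq'⟩ := Set.exists_min_image
    {r | G.Adj v r ∧ X v < X r ∧ slopeOf X Y v q < slopeOf X Y v r} (slopeOf X Y v)
    (Set.toFinite _) ⟨r, hr, hlt', hs⟩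
  obtain ⟨w, ⟨g1, g2, g3⟩, hw⟩ := Set.exists_min_image
    {r | X v < X r ∧ slopeOf X Y v q ≤ slopeOf X Y v r ∧ slopeOf X Y v r ≤ slopeOf X Y v q'} X
    (Set.toFinite _) ⟨q, hlt, le_rfl, h3.le⟩
  exact ⟨q', w, hq, h1, hlt, h2, h3, fun r a b c => hq' r ⟨a, b, c⟩, g1, g2, g3,
    fun r a b c => hw r ⟨a, b, c⟩⟩

theorem IsWedge.w_le_q {G : SimpleGraph V} {v q q' w : V} (h : IsWedge X Y G v q q' w) :
    X w ≤ X q := h.min_w q h.lt le_rfl h.slope_lt.le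

theorem IsWedge.w_le_q' {G : SimpleGraph V} {v q q' w : V} (h : IsWedge X Y G v q q' w) :
    X w ≤ X q' := h.min_w q' h.lt' h.slope_lt.le le_rfl

/-- Two wedges with the same leftmost vertex `w`, both lying on the same side of `w`, do not have
apices with different abscissae. -/
theorem IsWedge.not_lt_of_same_side {G : SimpleGraph V} (hG : NoCrossing X Y G)
    (hslope : ∀ a b c, X a < X b → X a < X c → b ≠ c → slopeOf X Y a b ≠ slopeOf X Y a c)
    {v q q' w v₂ q₂ q₂' : V} (h : IsWedge X Y G v q q' w)
    (h₂ : IsWedge X Y G v₂ q₂ q₂' w) (hside : w = q ↔ w = q₂) : ¬ X v < X v₂ := by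
  intro hlt
  -- `v₂` is to the left of `w`, the leftmost vertex of the wedge at `v`, hence outside that wedge:
  -- strictly above `vq'` or strictly below `vq`. Yet both wedges contain `w`, so some edge of one
  -- must change sides with an edge of the other.
  have hout : ¬ (slopeOf X Y v q ≤ slopeOf X Y v v₂ ∧ slopeOf X Y v v₂ ≤ slopeOf X Y v q') :=
    fun H => absurd (h.min_w v₂ hlt H.1 H.2) (not_le.2 h₂.lt_w)
  rw [slopeOf_le_iff hlt, le_slopeOf_iff hlt] at hout
  have e1 := (slopeOf_le_iff h.lt_w).1 h.le_w
  have e2 := (le_slopeOf_iff h.lt_w).1 h.w_le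
  have f1 := (slopeOf_le_iff h₂.lt_w).1 h₂.le_w
  have f2 := (le_slopeOf_iff h₂.lt_w).1 h₂.w_le
  -- Here `hside` matters: in either case it makes one of the two comparisons at `X w` strict.
  have strict : ∀ {v q q' : V}, IsWedge X Y G v q q' w → w ≠ q →
      segLine X Y v q (X w) < Y w := fun {v q q'} h hw => by
    rw [← segLine_right (Y := Y) h.lt_w]
    exact segLine_lt_segLine h.lt_w (lt_of_le_of_ne h.le_w (hslope _ _ _ h.lt h.lt_w hw.symm))
  have strict' : ∀ {v q q' : V}, IsWedge X Y G v q q' w → w = q →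
      Y w < segLine X Y v q' (X w) := fun {v q q'} h hw => by
    rw [← segLine_right (Y := Y) h.lt_w]
    exact segLine_lt_segLine h.lt_w (hw ▸ h.slope_lt)
  have key : segLine X Y v q (X v₂) ≤ Y v₂ → segLine X Y v q' (X v₂) < Y v₂ := by
    intro H; by_contra! H'; exact hout ⟨H, H'⟩
  by_cases hb : segLine X Y v q (X v₂) ≤ Y v₂
  · refine hG.not_swap h.adj' h₂.adj h₂.lt_w hlt.le le_rfl h.w_le_q' h₂.w_le_q
      (by rw [segLine_left]; exact key hb) ?_
    by_cases hw : w = q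
    · exact f1.trans_lt (strict' h hw)
    · exact (strict h₂ (hside.not.1 hw)).trans_le e2
  · push Not at hb
    refine hG.not_swap h₂.adj' h.adj h₂.lt_w le_rfl hlt.le h₂.w_le_q' h.w_le_q
      (by rw [segLine_left]; exact hb) ?_
    by_cases hw : w = q
    · exact e1.trans_lt (strict' h₂ (hside.1 hw))
    · exact (strict h hw).trans_le f2

/-- The apices agree by the preceding lemma. Two different wedges at one apex share at most a
boundary ray, which is the lower ray of one of them; `w` would lie on it and so equal that wedge's
lower endpoint. -/
theorem IsWedge.eq_of_same_side {G : SimpleGraph V} (hG : NoCrossing X Y G)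
    (hX : Function.Injective X)
    (hslope : ∀ a b c, X a < X b → X a < X c → b ≠ c → slopeOf X Y a b ≠ slopeOf X Y a c)
    {v q q' w v₂ q₂ q₂' : V} (h : IsWedge X Y G v q q' w)
    (h₂ : IsWedge X Y G v₂ q₂ q₂' w) (hside : w = q ↔ w = q₂) : v = v₂ ∧ q = q₂ := by
  have hv : v = v₂ := hX <| le_antisymm
    (not_lt.1 (h₂.not_lt_of_same_side hG hslope h hside.symm))
    (not_lt.1 (h.not_lt_of_same_side hG hslope h₂ hside))
  subst hv
  refine ⟨rfl, ?_⟩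
  by_cases hw : w = q
  · exact hw.symm.trans (hside.1 hw)
  have hw₂ := hside.not.1 hw
  by_contra hne
  rcases lt_or_gt_of_ne (hslope _ _ _ h.lt h₂.lt hne) with hl | hl
  · have := h.slope_le _ h₂.adj h₂.lt hl
    exact hslope _ _ _ h₂.lt h₂.lt_w (Ne.symm hw₂)
      (le_antisymm h₂.le_w (h.w_le.trans this))
  · have := h₂.slope_le _ h.adj h.lt hl
    exact hslope _ _ _ h.lt h.lt_w (Ne.symm hw)
      (le_antisymm h.le_w (h₂.w_le.trans this))

open Classical in
/-- A crossing-free straight-line graph on `n` points has at most `3 n` edges. -/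
theorem NoCrossing.card_right_edges_le [Fintype V] {G : SimpleGraph V} (hG : NoCrossing X Y G)
    (hX : Function.Injective X)
    (hslope : ∀ a b c, X a < X b → X a < X c → b ≠ c → slopeOf X Y a b ≠ slopeOf X Y a c) :
    (Finset.univ.filter fun e : V × V => G.Adj e.1 e.2 ∧ X e.1 < X e.2).card
      ≤ 3 * Fintype.card V := by
  set R := Finset.univ.filter fun e : V × V => G.Adj e.1 e.2 ∧ X e.1 < X e.2 with hR
  let P : V × V → Prop := fun e => ∃ q' w, IsWedge X Y G e.1 e.2 q' w
  rw [← Finset.card_filter_add_card_filter_not P]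
  -- An edge with a steeper successor is charged to the leftmost vertex `w` of its wedge, the
  -- Boolean recording whether `w` is the lower endpoint; each vertex is charged at most twice.
  have h1 : (R.filter P).card ≤ (Finset.univ : Finset (V × Bool)).card := by
    have hex : ∀ e : V × V, ∃ w : V, P e → ∃ q', IsWedge X Y G e.1 e.2 q' w := fun e => by
      by_cases h : P e
      · obtain ⟨q', w, h⟩ := h
        exact ⟨w, fun _ => ⟨q', h⟩⟩
      · exact ⟨e.1, fun h' => absurd h' h⟩
    choose W hW using hex
    refine Finset.card_le_card_of_injOn (fun e => (W e, decide (W e = e.2)))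
      (fun _ _ => Finset.mem_coe.2 (Finset.mem_univ _)) ?_
    intro e he f hf hef
    obtain ⟨q', h⟩ := hW e (Finset.mem_filter.1 he).2
    obtain ⟨r', h'⟩ := hW f (Finset.mem_filter.1 hf).2
    simp only [Prod.mk.injEq, decide_eq_decide] at hef
    obtain ⟨hw, hs⟩ := hef
    rw [hw] at h hs
    have := h.eq_of_same_side hG hX hslope h' hs
    exact Prod.ext this.1 this.2
  -- The remaining edges are the steepest ones at their left endpoints, at most one per vertex.
  have h2 : (R.filter fun e => ¬ P e).card ≤ (Finset.univ : Finset V).card := by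
    refine Finset.card_le_card_of_injOn Prod.fst
      (fun _ _ => Finset.mem_coe.2 (Finset.mem_univ _)) ?_
    rintro ⟨v, q⟩ he ⟨v', r⟩ hf (rfl : v = v')
    simp only [Finset.coe_filter, Set.mem_ofPred_eq, hR, Finset.mem_filter, Finset.mem_univ,
      true_and] at he hf
    by_contra hne
    have hqr : q ≠ r := fun h => hne (by rw [h])
    rcases lt_or_gt_of_ne (hslope v q r he.1.2 hf.1.2 hqr) with hl | hl
    · exact he.2 (exists_isWedge he.1.1 he.1.2 hf.1.1 hf.1.2 hl)
    · exact hf.2 (exists_isWedge hf.1.1 hf.1.2 he.1.1 he.1.2 hl)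
  rw [Finset.card_univ, Fintype.card_prod, Fintype.card_bool] at h1
  rw [Finset.card_univ] at h2
  omega

open Classical in
theorem NoCrossing.sum_degree_le [Fintype V] {G : SimpleGraph V} (hG : NoCrossing X Y G)
    (hX : Function.Injective X)
    (hslope : ∀ a b c, X a < X b → X a < X c → b ≠ c → slopeOf X Y a b ≠ slopeOf X Y a c) :
    ∑ v, G.degree v ≤ 6 * Fintype.card V := by
  have hle := hG.card_right_edges_le hX hslope
  have hE : G.edgeFinset.card ≤
      (Finset.univ.filter fun e : V × V => G.Adj e.1 e.2 ∧ X e.1 < X e.2).card := by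
    refine Finset.card_le_card_of_surjOn (fun e => s(e.1, e.2)) ?_
    intro e he
    induction e with | _ a b
    have hab : G.Adj a b := by simpa using he
    rcases lt_or_gt_of_ne (hX.ne hab.ne) with h | h
    · exact ⟨(a, b), by simp [hab, h], rfl⟩
    · exact ⟨(b, a), by simp [hab.symm, h], Sym2.eq_swap⟩
  rw [G.sum_degrees_eq_twice_card_edges]
  omega

end EdgeBound

/-! ### Visibility from an isolated point. -/

section Visibility

variable {V : Type*}

/-- The open segments `ab` and `cd` have a common point, in the coordinates `X` and `Y`. -/
def Meets (X Y : V → ℝ) (a b c d : V) : Prop :=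
  ∃ α β : ℝ, 0 < α ∧ α < 1 ∧ 0 < β ∧ β < 1 ∧
    X a + α * (X b - X a) = X c + β * (X d - X c) ∧
    Y a + α * (Y b - Y a) = Y c + β * (Y d - Y c)

variable {X Y : V → ℝ}

theorem Meets.swap_right {a b c d : V} (h : Meets X Y a b c d) : Meets X Y a b d c := by
  obtain ⟨α, β, h1, h2, h3, h4, h5, h6⟩ := h
  exact ⟨α, 1 - β, h1, h2, by linarith, by linarith, by linarith, by linarith⟩

/-- Twice the signed area of the triangle `abc`. -/
def orient (X Y : V → ℝ) (a b c : V) : ℝ :=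
  (X b - X a) * (Y c - Y a) - (Y b - Y a) * (X c - X a)

set_option maxHeartbeats 800000 in
/-- If an edge blocks the view from the isolated point `p` to `q`, then some point strictly above the
axis `pq` is visible from `p`: take the point of least angle in the triangle that the first blocking
edge `ab` cuts off. -/
theorem exists_visible_of_blocked [Finite V] {G : SimpleGraph V}
    (hgp : ∀ a b c, a ≠ b → a ≠ c → b ≠ c → orient X Y a b c ≠ 0)
    (hG : ∀ a b c d, G.Adj a b → G.Adj c d → s(a, b) ≠ s(c, d) → ¬ Meets X Y a b c d)
    {p q : V} (hp : ∀ u, ¬ G.Adj p u) (hpX : X p = 0) (hpY : Y p = 0) (hqX : 0 < X q)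
    (hqY : Y q = 0) {c₀ d₀ : V} (hcd : G.Adj c₀ d₀) (hm : Meets X Y p q c₀ d₀) :
    ∃ r, 0 < Y r ∧ ∀ u v, G.Adj u v → ¬ Meets X Y p r u v := by
  have hpq : p ≠ q := by rintro rfl; linarith
  have hnep : ∀ {u v}, G.Adj u v → u ≠ p := by rintro u v h rfl; exact hp _ h
  have hY0 : ∀ u, u ≠ p → Y u = 0 → u = q := by
    intro u hu h0
    by_contra hne
    apply hgp p q u hpq hu.symm (Ne.symm hne)
    simp [orient, hpX, hpY, hqY, h0]
  -- the abscissa at which an edge meets the axis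
  let ξ : V × V → ℝ := fun e => (X e.1 * Y e.2 - X e.2 * Y e.1) / (Y e.2 - Y e.1)
  let B : Set (V × V) := {e | G.Adj e.1 e.2 ∧ 0 < Y e.1 ∧ Y e.2 < 0 ∧ 0 < ξ e ∧ ξ e < X q}
  have hB : B.Nonempty := by
    have aux : ∀ c d, G.Adj c d → Meets X Y p q c d → 0 < Y c → (c, d) ∈ B := by
      rintro c d hcd ⟨α, β, h1, h2, h3, h4, h5, h6⟩ hc
      rw [hpX] at h5
      rw [hpY, hqY] at h6
      have hd : Y d < 0 := by
        by_contra! hd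
        nlinarith
      have hξ : ξ (c, d) = α * X q := by
        have : Y d - Y c ≠ 0 := by linarith
        simp only [ξ]
        rw [div_eq_iff this]
        linear_combination (-(Y d - Y c)) * h5 + (X d - X c) * h6
      refine ⟨hcd, hc, hd, ?_, ?_⟩
      · rw [hξ]; positivity
      · rw [hξ]; nlinarith
    rcases lt_trichotomy (Y c₀) 0 with h | h | h
    · obtain ⟨α, β, h1, h2, h3, h4, h5, h6⟩ := hm
      refine ⟨(d₀, c₀), aux d₀ c₀ hcd.symm (Meets.swap_right ⟨α, β, h1, h2, h3, h4, h5, h6⟩) ?_⟩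
      rw [hpY, hqY] at h6
      by_contra! hd
      nlinarith
    · obtain ⟨α, β, h1, h2, h3, h4, h5, h6⟩ := hm
      have hc := hY0 c₀ (hnep hcd) h
      rw [hpY, hqY, h] at h6
      have hd : Y d₀ = 0 := by
        have : β * Y d₀ = 0 := by linarith
        exact (mul_eq_zero.1 this).resolve_left h3.ne'
      exact absurd (hc.trans (hY0 d₀ (hnep hcd.symm) hd).symm) hcd.ne
    · exact ⟨(c₀, d₀), aux c₀ d₀ hcd hm h⟩
  obtain ⟨⟨a, b⟩, ⟨hab, ha, hb, hξ0, hξq⟩, hmin⟩ := Set.exists_min_image B ξ (Set.toFinite _) hB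
  simp only at hab ha hb
  set x₀ := ξ (a, b) with hx₀
  have hx₀' : X a * Y b - X b * Y a = x₀ * (Y b - Y a) := by
    rw [hx₀]
    simp only [ξ]
    rw [div_mul_cancel₀]
    linarith
  -- the edge `ab` as a line: negative at `p`
  let L : ℝ → ℝ → ℝ := fun x y => (X b - X a) * (y - Y a) - (Y b - Y a) * (x - X a)
  have hL : ∀ x y, L x y = (X b - X a) * y - (Y b - Y a) * (x - x₀) := by
    intro x y
    simp only [L]
    linear_combination hx₀'
  have hLp : L 0 0 < 0 := by rw [hL]; nlinarith
  -- The conditions cut out the triangle with corners `p`, `a` and `(x₀, 0)`, without its side on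
  -- the axis. Maximal `X / Y` means least angle with the axis.
  obtain ⟨r, ⟨hr, hra, hrL⟩, hmax⟩ := Set.exists_max_image
    {u | 0 < Y u ∧ X a * Y u - Y a * X u ≤ 0 ∧ L (X u) (Y u) ≤ 0} (fun u => X u / Y u)
    (Set.toFinite _) ⟨a, ha, by linarith, by simp [L]⟩
  refine ⟨r, hr, ?_⟩
  have hrp : r ≠ p := by rintro rfl; linarith
  -- The sign condition says that `u` is on the clockwise side of the ray `pr`. The edge `uv` is
  -- followed from its point on `pr` towards `u`.
  have key : ∀ u v, G.Adj u v → 0 < X u * Y r - Y u * X r → ¬ Meets X Y p r u v := by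
    rintro u v huv hD ⟨s, β, hs0, hs1, hβ0, hβ1, ex, ey⟩
    rw [hpX, sub_zero, zero_add] at ex
    rw [hpY, sub_zero, zero_add] at ey
    have hup := hnep huv
    have hzL : L (s * X r) (s * Y r) < 0 := by
      have : L (s * X r) (s * Y r) = (1 - s) * L 0 0 + s * L (X r) (Y r) := by
        simp only [L]; ring
      rw [this]
      have h1 := mul_neg_of_pos_of_neg (sub_pos.2 hs1) hLp
      have h2 := mul_nonpos_of_nonneg_of_nonpos hs0.le hrL
      linarith
    have hzY : 0 < s * Y r := by positivity
    -- the part of `uv` between `pr` and `u` does not reach `ab` above the axis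
    have hhit : ∀ τ : ℝ, 0 < τ → τ ≤ 1 → 0 ≤ s * Y r + τ * (Y u - s * Y r) →
        L (s * X r + τ * (X u - s * X r)) (s * Y r + τ * (Y u - s * Y r)) ≠ 0 := by
      intro τ hτ0 hτ1 hwY hwL
      set wx := s * X r + τ * (X u - s * X r) with hwx
      set wy := s * Y r + τ * (Y u - s * Y r) with hwy
      have hDw : 0 < wx * Y r - wy * X r := by
        have : wx * Y r - wy * X r = τ * (X u * Y r - Y u * X r) := by rw [hwx, hwy]; ring
        rw [this]; positivity
      have hba : Y a - Y b ≠ 0 := by linarith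
      set γ := (Y a - wy) / (Y a - Y b) with hγ
      have hγy : wy = Y a + γ * (Y b - Y a) := by
        rw [hγ]; field_simp; ring
      have hγx : wx = X a + γ * (X b - X a) := by
        have h1 : L wx wy = (Y a - Y b) * (wx - (X a + γ * (X b - X a))) := by
          simp only [L]
          rw [hγy]
          ring
        rw [h1] at hwL
        linarith [(mul_eq_zero.1 hwL).resolve_left hba]
      have hγ1 : γ < 1 := by
        rw [hγ, div_lt_one (by linarith)]
        linarith
      have hDa : X a * Y r - Y a * X r ≤ 0 := hra
      have hDb : 0 < X b * Y r - Y b * X r := by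
        have h1 : (Y a - Y b) * (x₀ * Y r) =
            Y a * (X b * Y r - Y b * X r) - Y b * (X a * Y r - Y a * X r) := by
          linear_combination Y r * hx₀'
        have h2 : 0 < (Y a - Y b) * (x₀ * Y r) :=
          mul_pos (by linarith) (mul_pos hξ0 hr)
        have h3 : 0 ≤ Y b * (X a * Y r - Y a * X r) := mul_nonneg_of_nonpos_of_nonpos hb.le hDa
        have h4 : 0 < Y a * (X b * Y r - Y b * X r) := by linarith
        exact (mul_pos_iff_of_pos_left ha).1 h4
      have hγ0 : 0 < γ := by
        have h1 : wx * Y r - wy * X r = (1 - γ) * (X a * Y r - Y a * X r) +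
            γ * (X b * Y r - Y b * X r) := by rw [hγx, hγy]; ring
        have h2 := mul_nonpos_of_nonneg_of_nonpos (a := 1 - γ) (by linarith) hDa
        have h3 : 0 < γ * (X b * Y r - Y b * X r) := by linarith
        exact (mul_pos_iff_of_pos_right hDb).1 h3
      -- Before `u` the two edges would cross; at `u` itself the points `a`, `b`, `u` would be
      -- collinear.
      rcases hτ1.lt_or_eq with hτ1 | hτ1
      · have hne : s(u, v) ≠ s(a, b) := by
          intro h
          apply hzL.ne
          rw [ex, ey]
          rcases Sym2.eq_iff.1 h with ⟨rfl, rfl⟩ | ⟨rfl, rfl⟩ <;> simp only [L] <;> ring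
        refine hG u v a b huv hab hne ⟨β * (1 - τ), γ, mul_pos hβ0 (by linarith),
          mul_lt_one_of_nonneg_of_lt_one_left hβ0.le hβ1 (by linarith), hγ0, hγ1, ?_, ?_⟩
        · rw [← hγx, hwx, ex]; ring
        · rw [← hγy, hwy, ey]; ring
      · have hwu : wx = X u := by rw [hwx, hτ1]; ring
        have hwu' : wy = Y u := by rw [hwy, hτ1]; ring
        rw [hwu, hwu'] at hwL
        have hua : u ≠ a := by rintro rfl; linarith
        have hub : u ≠ b := by rintro rfl; linarith
        exact hgp a b u hab.ne hua.symm hub.symm hwL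
    -- nor does it reach the far side of `ab`
    have hside : ∀ τ : ℝ, 0 < τ → τ ≤ 1 → 0 ≤ s * Y r + τ * (Y u - s * Y r) →
        L (s * X r + τ * (X u - s * X r)) (s * Y r + τ * (Y u - s * Y r)) < 0 := by
      intro τ hτ0 hτ1 hwY
      by_contra! hwL
      set ℓz := L (s * X r) (s * Y r) with hℓz
      set ℓw := L (s * X r + τ * (X u - s * X r)) (s * Y r + τ * (Y u - s * Y r)) with hℓw
      -- The parameter at which `L`, affine along the segment, vanishes.
      set ρ := -ℓz / (ℓw - ℓz) with hρ
      have hd : 0 < ℓw - ℓz := by linarith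
      have hρ0 : 0 < ρ := div_pos (by linarith) hd
      have hρ1 : ρ ≤ 1 := by rw [hρ, div_le_one hd]; linarith
      refine hhit (ρ * τ) (mul_pos hρ0 hτ0) (mul_le_one₀ hρ1 hτ0.le hτ1) ?_ ?_
      · have : s * Y r + ρ * τ * (Y u - s * Y r) =
          (1 - ρ) * (s * Y r) + ρ * (s * Y r + τ * (Y u - s * Y r)) := by ring
        rw [this]
        exact add_nonneg (mul_nonneg (by linarith) hzY.le) (mul_nonneg hρ0.le hwY)
      · have h1 : L (s * X r + ρ * τ * (X u - s * X r)) (s * Y r + ρ * τ * (Y u - s * Y r)) =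
            ℓz + ρ * (ℓw - ℓz) := by
          rw [hℓz, hℓw]; simp only [L]; ring
        rw [h1, hρ, div_mul_cancel₀ _ hd.ne']
        ring
    -- If `u` is above the axis, it lies in the triangle at a smaller angle than `r`. Otherwise `uv`
    -- reaches the axis between `p` and `x₀`, against the choice of `ab`, or ends there at `q`,
    -- which lies beyond `x₀`.
    rcases lt_or_ge 0 (Y u) with hu | hu
    · have h1 := hside 1 one_pos le_rfl (by linarith)
      have hlt : X r / Y r < X u / Y u := by
        rw [div_lt_div_iff₀ hr hu]; linarith
      refine absurd (hmax u ⟨hu, ?_, ?_⟩) (not_le.2 hlt)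
      · have h2 : X a / Y a ≤ X r / Y r := by
          rw [div_le_div_iff₀ ha hr]; linarith
        have h3 := h2.trans hlt.le
        rw [div_le_div_iff₀ ha hu] at h3
        linarith
      · have e1 : s * X r + 1 * (X u - s * X r) = X u := by ring
        have e2 : s * Y r + 1 * (Y u - s * Y r) = Y u := by ring
        rw [e1, e2] at h1
        exact h1.le
    · have hd : 0 < s * Y r - Y u := by linarith
      set τ := s * Y r / (s * Y r - Y u) with hτ
      have hτ0 : 0 < τ := div_pos hzY hd
      have hτ1 : τ ≤ 1 := by rw [hτ, div_le_one hd]; linarith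
      have hwY : s * Y r + τ * (Y u - s * Y r) = 0 := by
        have : τ * (s * Y r - Y u) = s * Y r := div_mul_cancel₀ _ hd.ne'
        linarith
      have h1 := hside τ hτ0 hτ1 hwY.ge
      set x₁ := s * X r + τ * (X u - s * X r) with hx₁
      rw [hwY, hL] at h1
      have hx₁0 : 0 < x₁ := by
        have h2 : x₁ * Y r = τ * (X u * Y r - Y u * X r) := by
          rw [hx₁]
          linear_combination X r * hwY
        have h3 : 0 < x₁ * Y r := by rw [h2]; positivity
        exact (mul_pos_iff_of_pos_right hr).1 h3
      have hx₁x₀ : x₁ < x₀ := by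
        by_contra! h
        have := mul_nonneg (show 0 ≤ Y a - Y b by linarith) (sub_nonneg.2 h)
        linarith
      rcases hu.lt_or_eq with hu | hu
      · have hv : 0 < Y v := by
          by_contra! hv
          have h2 := mul_neg_of_pos_of_neg (sub_pos.2 hβ1) hu
          have h3 := mul_nonpos_of_nonneg_of_nonpos hβ0.le hv
          linarith
        have hξ : ξ (v, u) = x₁ := by
          simp only [ξ]
          have hvu : Y u - Y v ≠ 0 := by linarith
          rw [div_eq_iff hvu]
          have h4 : x₁ = X u + (1 - τ) * β * (X v - X u) := by rw [hx₁, ex]; ring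
          have h5 : 0 = Y u + (1 - τ) * β * (Y v - Y u) := by rw [← hwY, ey]; ring
          linear_combination -(Y u - Y v) * h4 - (X v - X u) * h5
        exact absurd (hmin (v, u) ⟨huv.symm, hv, hu, by rwa [hξ], by rw [hξ]; linarith⟩)
          (by rw [hξ]; exact not_le.2 hx₁x₀)
      · have huq := hY0 u hup hu
        have hτe : τ = 1 := by
          rw [hτ, hu, sub_zero]; exact div_self hzY.ne'
        have : x₁ = X q := by rw [hx₁, hτe, ← huq]; ring
        linarith
  intro u v huv hm
  have hD : ∀ {u v}, G.Adj u v → X u * Y r - Y u * X r = 0 → u = r := by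
    intro u v huv h0
    by_contra hne
    apply hgp p r u hrp.symm (hnep huv).symm (Ne.symm hne)
    simp only [orient, hpX, hpY, sub_zero]
    linarith
  rcases lt_trichotomy 0 (X u * Y r - Y u * X r) with h | h | h
  · exact key u v huv h hm
  · obtain ⟨s, β, hs0, hs1, hβ0, hβ1, ex, ey⟩ := hm
    rw [hpX, sub_zero, zero_add] at ex
    rw [hpY, sub_zero, zero_add] at ey
    have h1 : β * (X v * Y r - Y v * X r) = 0 := by
      linear_combination X r * ey - Y r * ex + (1 - β) * h
    have h2 := (mul_eq_zero.1 h1).resolve_left hβ0.ne'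
    exact huv.ne ((hD huv h.symm).trans (hD huv.symm h2).symm)
  · refine key v u huv.symm ?_ hm.swap_right
    obtain ⟨s, β, hs0, hs1, hβ0, hβ1, ex, ey⟩ := hm
    rw [hpX, sub_zero, zero_add] at ex
    rw [hpY, sub_zero, zero_add] at ey
    have h1 : β * (X v * Y r - Y v * X r) = -(1 - β) * (X u * Y r - Y u * X r) := by
      linear_combination X r * ey - Y r * ex
    have h2 : 0 < β * (X v * Y r - Y v * X r) := by
      rw [h1]; nlinarith
    exact (mul_pos_iff_of_pos_left hβ0).1 h2

end Visibility

/-! ### Passage from the plane to affine coordinates. -/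

theorem mem_openSegment_iff_coords {a b z : Plane} :
    z ∈ openSegment ℝ a b ↔ ∃ t : ℝ, 0 < t ∧ t < 1 ∧ z 0 = a 0 + t * (b 0 - a 0) ∧
      z 1 = a 1 + t * (b 1 - a 1) := by
  rw [openSegment_eq_image']
  constructor
  · rintro ⟨t, ⟨h0, h1⟩, rfl⟩
    exact ⟨t, h0, h1, by simp, by simp⟩
  · rintro ⟨t, h0, h1, e0, e1⟩
    refine ⟨t, ⟨h0, h1⟩, ?_⟩
    ext i
    fin_cases i
    · simp [e0]
    · simp [e1]

theorem orient_ne_zero_of_not_collinear {a b c : Plane} (hab : a ≠ b)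
    (h : ¬ Collinear ℝ ({a, b, c} : Set Plane)) :
    (b 0 - a 0) * (c 1 - a 1) - (b 1 - a 1) * (c 0 - a 0) ≠ 0 := by
  intro h0
  apply h
  rw [collinear_iff_of_mem (p₀ := a) (by simp)]
  refine ⟨b - a, ?_⟩
  have hc : ∃ r : ℝ, c 0 = r * (b 0 - a 0) + a 0 ∧ c 1 = r * (b 1 - a 1) + a 1 := by
    by_cases hx : b 0 - a 0 = 0
    · have hy : b 1 - a 1 ≠ 0 := by
        intro hy
        apply hab
        ext i
        fin_cases i
        · simpa using (sub_eq_zero.1 hx).symm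
        · simpa using (sub_eq_zero.1 hy).symm
      refine ⟨(c 1 - a 1) / (b 1 - a 1), ?_, by field_simp; ring⟩
      rw [hx, zero_mul, zero_sub, neg_eq_zero] at h0
      rw [hx, mul_zero, zero_add]
      exact sub_eq_zero.1 ((mul_eq_zero.1 h0).resolve_left hy)
    · refine ⟨(c 0 - a 0) / (b 0 - a 0), by field_simp; ring, ?_⟩
      field_simp
      linarith
  obtain ⟨r, h1, h2⟩ := hc
  rintro p (rfl | rfl | rfl)
  · exact ⟨0, by simp⟩
  · exact ⟨1, by simp⟩
  · refine ⟨r, ?_⟩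
    ext i
    fin_cases i
    · simpa using h1
    · simpa using h2

/-- Disjointness of open segments can be tested in any affine coordinates. -/
theorem disjoint_openSegment_iff_not_meets {S : Finset Plane} {X Y : S → ℝ}
    {x₁ x₂ x₃ y₁ y₂ y₃ : ℝ} (hX : ∀ u : S, X u = x₁ * u.1 0 + x₂ * u.1 1 + x₃)
    (hY : ∀ u : S, Y u = y₁ * u.1 0 + y₂ * u.1 1 + y₃) (hdet : x₁ * y₂ - x₂ * y₁ ≠ 0)
    (a b c d : S) :
    Disjoint (openSegment ℝ (a : Plane) b) (openSegment ℝ (c : Plane) d) ↔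
      ¬ Meets X Y a b c d := by
  rw [← not_iff_not, not_not, Set.not_disjoint_iff]
  simp only [mem_openSegment_iff_coords]
  constructor
  · rintro ⟨z, ⟨α, h1, h2, e1, e2⟩, β, h3, h4, e3, e4⟩
    refine ⟨α, β, h1, h2, h3, h4, ?_, ?_⟩
    · simp only [hX]
      linear_combination x₁ * (e3 - e1) + x₂ * (e4 - e2)
    · simp only [hY]
      linear_combination y₁ * (e3 - e1) + y₂ * (e4 - e2)
  · rintro ⟨α, β, h1, h2, h3, h4, e1, e2⟩
    simp only [hX] at e1
    simp only [hY] at e2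
    refine ⟨!₂[a.1 0 + α * (b.1 0 - a.1 0), a.1 1 + α * (b.1 1 - a.1 1)],
      ⟨α, h1, h2, by simp, by simp⟩, β, h3, h4, ?_, ?_⟩
    · simp only [Matrix.cons_val_zero]
      apply mul_left_cancel₀ hdet
      linear_combination y₂ * e1 - x₂ * e2
    · simp only [Matrix.cons_val_one, Matrix.cons_val_zero]
      apply mul_left_cancel₀ hdet
      linear_combination x₁ * e2 - y₁ * e1

theorem InGeneralPosition.orient_ne_zero {S : Finset Plane} (hS : InGeneralPosition S)
    {X Y : S → ℝ} {x₁ x₂ x₃ y₁ y₂ y₃ : ℝ} (hX : ∀ u : S, X u = x₁ * u.1 0 + x₂ * u.1 1 + x₃)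
    (hY : ∀ u : S, Y u = y₁ * u.1 0 + y₂ * u.1 1 + y₃) (hdet : x₁ * y₂ - x₂ * y₁ ≠ 0)
    (a b c : S) (hab : a ≠ b) (hac : a ≠ c) (hbc : b ≠ c) : orient X Y a b c ≠ 0 := by
  have h := orient_ne_zero_of_not_collinear (Subtype.coe_injective.ne hab)
    (hS a a.2 b b.2 c c.2 (Subtype.coe_injective.ne hab) (Subtype.coe_injective.ne hac)
      (Subtype.coe_injective.ne hbc))
  have : orient X Y a b c = (x₁ * y₂ - x₂ * y₁) *
      ((b.1 0 - a.1 0) * (c.1 1 - a.1 1) - (b.1 1 - a.1 1) * (c.1 0 - a.1 0)) := by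
    simp only [orient, hX, hY]
    ring
  rw [this]
  exact mul_ne_zero hdet h

/-- Each pair of points excludes at most one `t`. The resulting shear gives the distinct abscissae
needed for the edge bound. -/
theorem exists_injective_coordinate (S : Finset Plane) :
    ∃ t : ℝ, Function.Injective fun u : S => u.1 0 + t * u.1 1 := by
  obtain ⟨t, ht⟩ := (Set.finite_range fun e : S × S =>
    -(e.1.1 0 - e.2.1 0) / (e.1.1 1 - e.2.1 1)).exists_notMem
  refine ⟨t, fun a b hab => ?_⟩
  by_contra hne
  simp only at hab
  by_cases h1 : a.1 1 - b.1 1 = 0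
  · apply hne
    apply Subtype.ext
    ext i
    fin_cases i
    · have := sub_eq_zero.1 h1
      rw [this] at hab
      simpa using hab
    · simpa using sub_eq_zero.1 h1
  · refine ht ⟨(a, b), ?_⟩
    simp only
    rw [div_eq_iff h1]
    linarith

open Classical in
/-- The degrees of a plane graph on `n` points in general position sum to at most `6 n`. -/
theorem IsPlaneGraph.sum_degree_le {S : Finset Plane} (hS : InGeneralPosition S)
    {G : SimpleGraph S} (hG : IsPlaneGraph G) : ∑ v, G.degree v ≤ 6 * S.card := by
  obtain ⟨t, ht⟩ := exists_injective_coordinate S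
  set X : S → ℝ := fun u => u.1 0 + t * u.1 1 with hXdef
  set Y : S → ℝ := fun u => u.1 1 with hYdef
  have hX : ∀ u : S, X u = 1 * u.1 0 + t * u.1 1 + 0 := fun u => by simp [hXdef]
  have hY : ∀ u : S, Y u = 0 * u.1 0 + 1 * u.1 1 + 0 := fun u => by simp [hYdef]
  have hdet : (1 : ℝ) * 1 - t * 0 ≠ 0 := by norm_num
  rw [← Fintype.card_coe S]
  refine NoCrossing.sum_degree_le (X := X) (Y := Y) ?_ ht ?_
  · intro a b c d hab hcd hlt hlt' hne x h1 h2 h3 h4 heq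
    refine (disjoint_openSegment_iff_not_meets hX hY hdet a b c d).1 (hG a b c d hab hcd hne)
      ⟨(x - X a) / (X b - X a), (x - X c) / (X d - X c), div_pos (by linarith) (by linarith),
        (div_lt_one (by linarith)).2 (by linarith), div_pos (by linarith) (by linarith),
        (div_lt_one (by linarith)).2 (by linarith), ?_, ?_⟩
    · rw [div_mul_cancel₀ _ (by linarith), div_mul_cancel₀ _ (by linarith)]
      ring
    · simp only [segLine, slopeOf] at heq
      convert heq using 2 <;> ring
  · intro a b c hab hac hbc h
    refine hS.orient_ne_zero hX hY hdet a b c (fun h => ?_) (fun h => ?_) hbc ?_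
    · rw [h] at hab; exact lt_irrefl _ hab
    · rw [h] at hac; exact lt_irrefl _ hac
    · simp only [slopeOf] at h
      rw [div_eq_div_iff (by linarith) (by linarith)] at h
      simp only [orient]
      linarith

/-! ### Points visible from an isolated vertex. -/

open Classical in
/-- The points that can be joined to `p` without crossing an edge of `G`. -/
noncomputable def visibleFrom {S : Finset Plane} (G : SimpleGraph S) (p : S) : Finset S :=
  Finset.univ.filter fun q => q ≠ p ∧ ∀ c d, G.Adj c d →
    Disjoint (openSegment ℝ (p : Plane) q) (openSegment ℝ (c : Plane) d)

theorem mem_visibleFrom {S : Finset Plane} {G : SimpleGraph S} {p q : S} :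
    q ∈ visibleFrom G p ↔ q ≠ p ∧ ∀ c d, G.Adj c d →
      Disjoint (openSegment ℝ (p : Plane) q) (openSegment ℝ (c : Plane) d) := by
  simp [visibleFrom]

/-- In coordinates with origin `p` and first axis along `pq`, this is `exists_visible_of_blocked`.
The sign of `σ` selects the side of the line `pq`, so a blocked view yields a visible point on
either side. -/
theorem exists_mem_visibleFrom_side {S : Finset Plane} (hS : InGeneralPosition S)
    {G : SimpleGraph S} (hG : IsPlaneGraph G) {p q : S} (hp : ∀ u, ¬ G.Adj p u) (hpq : q ≠ p)
    (hq : q ∉ visibleFrom G p) {σ : ℝ} (hσ : σ ≠ 0) :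
    ∃ r ∈ visibleFrom G p, 0 < σ * ((q.1 0 - p.1 0) * (r.1 1 - p.1 1) -
      (q.1 1 - p.1 1) * (r.1 0 - p.1 0)) := by
  set x := q.1 0 - p.1 0 with hx
  set y := q.1 1 - p.1 1 with hy
  set X : S → ℝ := fun u => x * (u.1 0 - p.1 0) + y * (u.1 1 - p.1 1) with hXdef
  set Y : S → ℝ := fun u => σ * (x * (u.1 1 - p.1 1) - y * (u.1 0 - p.1 0)) with hYdef
  have hX : ∀ u : S, X u = x * u.1 0 + y * u.1 1 + (-x * p.1 0 - y * p.1 1) := fun u => by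
    simp only [hXdef]; ring
  have hY : ∀ u : S, Y u = (-σ * y) * u.1 0 + (σ * x) * u.1 1 +
      (-σ * x * p.1 1 + σ * y * p.1 0) := fun u => by
    simp only [hYdef]; ring
  have hpos : 0 < x * x + y * y := by
    by_contra! h
    have h1 : x = 0 := by nlinarith [mul_self_nonneg x, mul_self_nonneg y]
    have h2 : y = 0 := by nlinarith [mul_self_nonneg x, mul_self_nonneg y]
    apply hpq
    apply Subtype.ext
    ext i
    fin_cases i
    · simpa using sub_eq_zero.1 (hx.symm.trans h1)
    · simpa using sub_eq_zero.1 (hy.symm.trans h2)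
  have hdet : x * (σ * x) - y * (-σ * y) ≠ 0 := by
    have : x * (σ * x) - y * (-σ * y) = σ * (x * x + y * y) := by ring
    rw [this]
    exact mul_ne_zero hσ hpos.ne'
  have hiff := disjoint_openSegment_iff_not_meets hX hY hdet
  have hblock : ∃ c d, G.Adj c d ∧ Meets X Y p q c d := by
    by_contra! h
    exact hq (mem_visibleFrom.2 ⟨hpq, fun c d hcd => (hiff p q c d).2 (h c d hcd)⟩)
  obtain ⟨c, d, hcd, hm⟩ := hblock
  obtain ⟨r, hr, hvis⟩ := exists_visible_of_blocked (hS.orient_ne_zero hX hY hdet)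
    (fun a b c d hab hcd hne => (hiff a b c d).1 (hG a b c d hab hcd hne)) (q := q) hp
    (by simp [hXdef]) (by simp [hYdef]) (by simpa [hXdef] using hpos)
    (by simp only [hYdef]; rw [← hx, ← hy]; ring) hcd hm
  refine ⟨r, mem_visibleFrom.2 ⟨?_, fun u v huv => (hiff p r u v).2 (hvis u v huv)⟩, hr⟩
  rintro rfl
  simp [hYdef] at hr

theorem two_le_card_visibleFrom_of_blocked {S : Finset Plane} (hS : InGeneralPosition S)
    {G : SimpleGraph S} (hG : IsPlaneGraph G) {p q : S} (hp : ∀ u, ¬ G.Adj p u) (hpq : q ≠ p)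
    (hq : q ∉ visibleFrom G p) : 2 ≤ (visibleFrom G p).card := by
  obtain ⟨r, hr, h1⟩ := exists_mem_visibleFrom_side hS hG hp hpq hq (one_ne_zero)
  obtain ⟨r', hr', h2⟩ := exists_mem_visibleFrom_side hS hG hp hpq hq (neg_ne_zero.2 one_ne_zero)
  refine Nat.succ_le_of_lt (Finset.one_lt_card.2 ⟨r, hr, r', hr', ?_⟩)
  rintro rfl
  linarith

/-- An isolated point of a plane graph sees at least two other points, if there are that many. -/
theorem le_card_visibleFrom {S : Finset Plane} (hS : InGeneralPosition S)
    {G : SimpleGraph S} (hG : IsPlaneGraph G) {p : S} (hp : ∀ u, ¬ G.Adj p u) {i : ℕ}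
    (hi : i ≤ 2) (hcard : i + 1 ≤ S.card) : i ≤ (visibleFrom G p).card := by
  classical
  by_cases h : ∃ q, q ≠ p ∧ q ∉ visibleFrom G p
  · obtain ⟨q, hq, hq'⟩ := h
    exact hi.trans (two_le_card_visibleFrom_of_blocked hS hG hp hq hq')
  · push Not at h
    have h1 : Finset.univ.erase p ⊆ visibleFrom G p := fun q hq => h q (Finset.ne_of_mem_erase hq)
    have h2 := Finset.card_le_card h1
    rw [Finset.card_erase_of_mem (Finset.mem_univ p), Finset.card_univ, Fintype.card_coe] at h2
    omega

/-! ### The binomial inequality. -/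

/-- Equality holds at `k = 12`. From `k = 14` on the left side is not positive, which leaves
finitely many cases. -/
theorem choose_twelve_mul_le {i k : ℕ} (hi : i ≤ 2) (hik : i ≤ k) :
    (Nat.choose 12 i : ℝ) * 2 ^ k * (14 - k) ≤ 8192 * (k.choose i : ℝ) := by
  rcases le_or_gt 14 k with hk | hk
  · have : (14 : ℝ) ≤ k := by exact_mod_cast hk
    have h1 : (Nat.choose 12 i : ℝ) * 2 ^ k * (14 - k) ≤ 0 :=
      mul_nonpos_of_nonneg_of_nonpos (by positivity) (by linarith)
    exact h1.trans (by positivity)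
  · interval_cases i <;> interval_cases k <;> norm_num [Nat.choose]

/-- A uniformly random subset of a `k`-set has mean size `k / 2`, so the weights `7 - |U|` sum to `2
^ k * (14 - k) / 2`. -/
theorem sum_powerset_indicator_sub_nonneg {α : Type*} (T : Finset α) {i : ℕ} (hi : i ≤ 2)
    (hT : i ≤ T.card) :
    0 ≤ ∑ U ∈ T.powerset, ((if U.card = i then (1 : ℝ) else 0) -
      (Nat.choose 12 i : ℝ) / 4096 * (7 - U.card)) := by
  set k := T.card with hk
  have h1 : ∑ U ∈ T.powerset, (if U.card = i then (1 : ℝ) else 0) = k.choose i := by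
    rw [← Finset.sum_filter, Finset.sum_const, nsmul_eq_mul, mul_one,
      ← Finset.powersetCard_eq_filter, Finset.card_powersetCard]
  have h2 : ∑ U ∈ T.powerset, (U.card : ℝ) * 2 = k * 2 ^ k := by
    rw [← Finset.sum_mul, ← Nat.cast_sum, Finset.sum_powerset_apply_card (fun m => m)]
    have h := Nat.sum_range_mul_choose k
    simp only [smul_eq_mul, mul_comm, ← hk] at h ⊢
    rw [h]
    rcases k with _ | k
    · simp
    · push_cast
      ring
  have h3 : ∑ U ∈ T.powerset, (7 - (U.card : ℝ)) = 2 ^ k * (14 - k) / 2 := by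
    rw [Finset.sum_sub_distrib, Finset.sum_const, Finset.card_powerset, nsmul_eq_mul]
    rw [← Finset.sum_mul] at h2
    push_cast
    linarith
  rw [Finset.sum_sub_distrib, ← Finset.mul_sum, h1, h3]
  have := choose_twelve_mul_le hi hT
  linarith

/-! ### Joining a vertex to visible points. -/

section Star

variable {V : Type*}

/-- The graph obtained from `G` by joining `p` to all points of `T`. -/
def addStar (G : SimpleGraph V) (p : V) (T : Finset V) : SimpleGraph V where
  Adj a b := G.Adj a b ∨ (a = p ∧ b ∈ T ∧ b ≠ p) ∨ (b = p ∧ a ∈ T ∧ a ≠ p)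
  symm := ⟨fun a b h => by
    rcases h with h | h | h
    · exact Or.inl h.symm
    · exact Or.inr (Or.inr h)
    · exact Or.inr (Or.inl h)⟩
  loopless := ⟨fun a h => by
    rcases h with h | ⟨rfl, -, h⟩ | ⟨rfl, -, h⟩
    · exact G.loopless.irrefl a h
    · exact h rfl
    · exact h rfl⟩

theorem addStar_adj {G : SimpleGraph V} {p : V} {T : Finset V} {a b : V} :
    (addStar G p T).Adj a b ↔ G.Adj a b ∨ (a = p ∧ b ∈ T ∧ b ≠ p) ∨ (b = p ∧ a ∈ T ∧ a ≠ p) :=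
  Iff.rfl

end Star

theorem openSegment_star_disjoint {S : Finset Plane} (hS : InGeneralPosition S) {p q r : S}
    (hpq : q ≠ p) (hpr : r ≠ p) (hqr : q ≠ r) :
    Disjoint (openSegment ℝ (p : Plane) q) (openSegment ℝ (p : Plane) r) := by
  rw [Set.disjoint_left]
  intro z hz hz'
  rw [mem_openSegment_iff_coords] at hz hz'
  obtain ⟨α, h1, -, e1, e2⟩ := hz
  obtain ⟨β, h3, -, e3, e4⟩ := hz'
  have h := orient_ne_zero_of_not_collinear (Subtype.coe_injective.ne hpq.symm)
    (hS p p.2 q q.2 r r.2 (Subtype.coe_injective.ne hpq.symm)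
      (Subtype.coe_injective.ne hpr.symm) (Subtype.coe_injective.ne hqr))
  apply h
  -- A common point would make the vectors `α (q - p)` and `β (r - p)` equal, so their cross
  -- product, `α β` times the orientation of `p`, `q`, `r`, would vanish.
  apply mul_left_cancel₀ (mul_pos h1 h3).ne'
  linear_combination (α * (q.1 0 - p.1 0)) * (e2 - e4) - (α * (q.1 1 - p.1 1)) * (e1 - e3)

theorem addStar_isPlaneGraph {S : Finset Plane} (hS : InGeneralPosition S)
    {G : SimpleGraph S} (hG : IsPlaneGraph G) {p : S} {T : Finset S}
    (hT : T ⊆ visibleFrom G p) : IsPlaneGraph (addStar G p T) := by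
  have hstar : ∀ q ∈ T, ∀ c d, (addStar G p T).Adj c d → s(p, q) ≠ s(c, d) →
      Disjoint (openSegment ℝ (p : Plane) q) (openSegment ℝ (c : Plane) d) := by
    intro q hq c d hcd hne
    have hvis := mem_visibleFrom.1 (hT hq)
    rcases addStar_adj.1 hcd with h | ⟨rfl, h1, h2⟩ | ⟨rfl, h1, h2⟩
    · exact hvis.2 c d h
    · exact openSegment_star_disjoint hS hvis.1 h2 (fun h => hne (by rw [h]))
    · rw [openSegment_symm ℝ (c : Plane)]
      exact openSegment_star_disjoint hS hvis.1 h2 (fun h => hne (by rw [h, Sym2.eq_swap]))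
  intro a b c d hab hcd hne
  rcases addStar_adj.1 hab with h | ⟨rfl, h1, -⟩ | ⟨rfl, h1, -⟩
  · rcases addStar_adj.1 hcd with h' | ⟨rfl, h1, -⟩ | ⟨rfl, h1, -⟩
    · exact hG a b c d h h' hne
    · exact (hstar d h1 a b hab hne.symm).symm
    · rw [openSegment_symm ℝ (c : Plane)]
      exact (hstar c h1 a b hab (by rw [Sym2.eq_swap]; exact hne.symm)).symm
  · exact hstar b h1 c d hcd hne
  · rw [openSegment_symm ℝ (a : Plane)]
    exact hstar a h1 c d hcd (by rw [Sym2.eq_swap]; exact hne)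

/-! ### Fibres over the graphs without edges at `p`, and averaging. -/

theorem mem_planeGraphs {S : Finset Plane} {G : SimpleGraph S} :
    G ∈ planeGraphs S ↔ IsPlaneGraph G := by
  simp [planeGraphs]

theorem IsPlaneGraph.mono {S : Finset Plane} {G H : SimpleGraph S} (hG : IsPlaneGraph G)
    (h : H ≤ G) : IsPlaneGraph H :=
  fun a b c d hab hcd hne => hG a b c d (h hab) (h hcd) hne

open Classical in
/-- The plane graphs that agree with `H` off the isolated point `p` are obtained by joining `p` to
an arbitrary set of visible points. -/
theorem sum_planeGraphs_fiber {S : Finset Plane} (hS : InGeneralPosition S) {H : SimpleGraph S}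
    (hH : IsPlaneGraph H) {p : S} (hp : ∀ u, ¬ H.Adj p u) (f : ℕ → ℝ) :
    ∑ G ∈ planeGraphs S with G.deleteIncidenceSet p = H, f (G.degree p) =
      ∑ T ∈ (visibleFrom H p).powerset, f T.card := by
  refine Finset.sum_nbij' (fun G => G.neighborFinset p) (fun T => addStar H p T) ?_ ?_ ?_ ?_ ?_
  · intro G hG
    obtain ⟨hmem, rfl⟩ := Finset.mem_filter.1 hG
    replace hG := mem_planeGraphs.1 hmem
    refine Finset.mem_powerset.2 fun q hq => mem_visibleFrom.2 ?_
    rw [SimpleGraph.mem_neighborFinset] at hq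
    refine ⟨hq.ne', fun c d hcd => ?_⟩
    rw [SimpleGraph.deleteIncidenceSet_adj] at hcd
    refine hG p q c d hq hcd.1 fun h => ?_
    rcases Sym2.eq_iff.1 h with ⟨h, -⟩ | ⟨h, -⟩
    · exact hcd.2.1 h.symm
    · exact hcd.2.2 h.symm
  · intro T hT
    refine Finset.mem_filter.2
      ⟨mem_planeGraphs.2 (addStar_isPlaneGraph hS hH (Finset.mem_powerset.1 hT)), ?_⟩
    ext a b
    rw [SimpleGraph.deleteIncidenceSet_adj, addStar_adj]
    constructor
    · rintro ⟨h | h | h, h1, h2⟩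
      · exact h
      · exact absurd h.1 h1
      · exact absurd h.1 h2
    · intro h
      refine ⟨Or.inl h, ?_, ?_⟩
      · rintro rfl; exact hp _ h
      · rintro rfl; exact hp _ h.symm
  · intro G hG
    obtain ⟨hmem, rfl⟩ := Finset.mem_filter.1 hG
    ext a b
    simp only [addStar_adj, SimpleGraph.deleteIncidenceSet_adj, SimpleGraph.mem_neighborFinset]
    constructor
    · rintro (h | ⟨rfl, h, -⟩ | ⟨rfl, h, -⟩)
      · exact h.1
      · exact h
      · exact h.symm
    · intro h
      by_cases ha : a = p
      · subst ha
        exact Or.inr (Or.inl ⟨rfl, h, h.ne'⟩)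
      · by_cases hb : b = p
        · subst hb
          exact Or.inr (Or.inr ⟨rfl, h.symm, ha⟩)
        · exact Or.inl ⟨h, ha, hb⟩
  · intro T hT
    ext q
    rw [SimpleGraph.mem_neighborFinset, addStar_adj]
    constructor
    · rintro (h | h | h)
      · exact absurd h (hp q)
      · exact h.2.1
      · exact absurd rfl h.2.2
    · intro hq
      exact Or.inr (Or.inl ⟨rfl, hq,
        (mem_visibleFrom.1 (Finset.mem_powerset.1 hT hq)).1⟩)
  · intro G _
    rw [SimpleGraph.card_neighborFinset_eq_degree]

open Classical in
theorem sum_planeGraphs_indicator_sub_nonneg {S : Finset Plane} (hS : InGeneralPosition S)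
    {i : ℕ} (hi : i ≤ 2) (hcard : i + 1 ≤ S.card) (p : S) :
    0 ≤ ∑ G ∈ planeGraphs S, ((if G.degree p = i then (1 : ℝ) else 0) -
      (Nat.choose 12 i : ℝ) / 4096 * (7 - G.degree p)) := by
  rw [← Finset.sum_fiberwise_of_maps_to (t := Finset.univ)
    (g := fun G : SimpleGraph S => G.deleteIncidenceSet p) (fun _ _ => Finset.mem_univ _)]
  refine Finset.sum_nonneg fun H _ => ?_
  by_cases h : ∃ G ∈ planeGraphs S, G.deleteIncidenceSet p = H
  · obtain ⟨G, hG, rfl⟩ := h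
    have hH := (mem_planeGraphs.1 hG).mono (G.deleteIncidenceSet_le p)
    have hp : ∀ u, ¬ (G.deleteIncidenceSet p).Adj p u := fun u hu =>
      (SimpleGraph.deleteIncidenceSet_adj.1 hu).2.1 rfl
    rw [sum_planeGraphs_fiber hS hH hp fun m : ℕ => (if m = i then (1 : ℝ) else 0) -
      (Nat.choose 12 i : ℝ) / 4096 * (7 - m)]
    exact sum_powerset_indicator_sub_nonneg _ hi (le_card_visibleFrom hS hH hp hi hcard)
  · push Not at h
    rw [Finset.filter_eq_empty_iff.2 fun G hG => h G hG, Finset.sum_empty]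

open Classical in
theorem le_expectedNumDegree {S : Finset Plane} (hS : InGeneralPosition S)
    {i : ℕ} (hi : i ≤ 2) (hcard : i + 1 ≤ S.card) :
    (Nat.choose 12 i : ℝ) / 4096 * S.card ≤ expectedNumDegree i S := by
  have hbot : (⊥ : SimpleGraph S) ∈ planeGraphs S :=
    mem_planeGraphs.2 fun a b c d h => absurd h (by simp)
  have hpos : (0 : ℝ) < (planeGraphs S).card := by
    exact_mod_cast Finset.card_pos.2 ⟨_, hbot⟩
  rw [expectedNumDegree, le_div_iff₀ hpos]
  have h := Finset.sum_nonneg fun p (_ : p ∈ (Finset.univ : Finset S)) =>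
    sum_planeGraphs_indicator_sub_nonneg hS hi hcard p
  -- With the sum over graphs outside, the degree bound applies to each graph: the weights `7 - deg
  -- p` add up to at least `7 N - 6 N = N`.
  rw [Finset.sum_comm] at h
  have hle : ∀ G ∈ planeGraphs S, ∑ p : S, ((if G.degree p = i then (1 : ℝ) else 0) -
      (Nat.choose 12 i : ℝ) / 4096 * (7 - G.degree p)) ≤
      (numDegree i G : ℝ) - (Nat.choose 12 i : ℝ) / 4096 * S.card := by
    intro G hG
    have hdeg : (∑ p, (G.degree p : ℝ)) ≤ 6 * S.card := by
      exact_mod_cast (mem_planeGraphs.1 hG).sum_degree_le hS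
    rw [Finset.sum_sub_distrib, ← Finset.mul_sum, Finset.sum_sub_distrib, Finset.sum_boole,
      Finset.sum_const, Finset.card_univ, Fintype.card_coe, nsmul_eq_mul, numDegree]
    refine sub_le_sub_left (mul_le_mul_of_nonneg_left ?_ (by positivity)) _
    linarith
  have h' := h.trans (Finset.sum_le_sum hle)
  rw [Finset.sum_sub_distrib, Finset.sum_const, nsmul_eq_mul] at h'
  linarith

theorem mainTheorem9 (S : Finset Plane) (N : ℕ) (hN : S.card = N) (hS : InGeneralPosition S) :
    (N : ℝ) / 4096 ≤ expectedNumDegree 0 S ∧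
    (2 ≤ N → 3 * (N : ℝ) / 1024 ≤ expectedNumDegree 1 S) ∧
    (3 ≤ N → 33 * (N : ℝ) / 2048 ≤ expectedNumDegree 2 S) := by
  subst hN
  refine ⟨?_, fun h => ?_, fun h => ?_⟩
  -- The general bound needs `i + 1` points, so the empty set is treated separately.
  · rcases Nat.eq_zero_or_pos S.card with h0 | h0
    · rw [h0, Nat.cast_zero, zero_div]
      exact div_nonneg (Finset.sum_nonneg fun _ _ => Nat.cast_nonneg _) (Nat.cast_nonneg _)
    · have := le_expectedNumDegree hS (i := 0) (by norm_num) h0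
      norm_num at this
      linarith
  · have := le_expectedNumDegree hS (i := 1) (by norm_num) h
    norm_num at this
    linarith
  · have := le_expectedNumDegree hS (i := 2) (by norm_num) h
    norm_num [Nat.choose] at this
    linarith
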